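/- **Theorem ($L$-Hausdorff–Young–Paley inequality).** Let $\overline{M}$ be a smooth $n$-dimensional manifold with (possibly empty) boundary, equipped with a measure $dx$ given by a smooth volume form, that is, of the form $|g|\,dx_1\cdots dx_n$ with $g$ real and smooth in local coordinates. Let $L$ be a densely defined linear operator on $L^2(\overline{M})$ (boundary conditions being encoded in its domain) with adjoint $L^*$, let $\mathcal I$ be a countable set, and let $\lambda_\xi\in\mathbb C$, $u_\xi\in \mathrm{Dom}(L)$, $v_\xi\in\mathrm{Dom}(L^*)$ $(\xi\in\mathcal I)$ satisfy $$Lu_\xi=\lambda_\xi u_\xi,\qquad L^*v_\xi=\overline{\lambda_\xi}\,v_\xi,\qquad \|u_\xi\|_{L^2}=1,\qquad \int_{\overline M}u_\xi\overline{v_\eta}\,dx=\delta_{\xi\eta}\qquad(\xi,\eta\in\mathcal I).$$ Assume that $\{u_\xi\}$ is a Riesz basis of $L^2(\overline M)$: every $f\in L^2(\overline{M})$ is the sum of a unique series $\sum_{\xi}a_\xi u_\xi$ that converges unconditionally in $L^2(\overline M)$. Write $\mathcal F_Lf(\xi)=\int_{\overline M}f(x)\overline{v_\xi(x)}\,dx$,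 and assume $$\sup_{\xi\in\mathcal I}\frac{\|v_\xi\|_{L^\infty(\overline M)}}{\|u_\xi\|_{L^\infty(\overline M)}}<\infty .$$ Let $1<p\le 2$ and $p'=\frac{p}{p-1}$. Then there is a finite constant $C$, depending only on $p$ (and on the fixed data $\overline M,dx,L,\{u_\xi\},\{v_\xi\}$), such that the following holds for every $b$ with $p\le b\le p'$, every positive function $\varphi$ on $\mathcal I$ with $$M_\varphi:=\sup_{t>0}\,t\sum_{\xi\in\mathcal I:\ t\le\varphi(\xi)}\|u_\xi\|_{L^\infty(\overline M)}^2<\infty,$$ and every $f\in L^p(\overline M)$: the integrals defining $\mathcal F_Lf(\xi)$ converge absolutely, and $$\left(\sum_{\xi\in\mathcal I}\Big(|\mathcal F_Lf(\xi)|\,\varphi(\xi)^{\frac1b-\frac1{p'}}\Big)^{b}\,\|u_\xi\|_{L^\infty(\overline M)}^{1-\frac b{p'}}\,\|v_\xi\|_{L^\infty(\overline M)}^{1-\frac bp}\right)^{\frac1b}\le C\,M_\varphi^{\frac1b-\frac1{p'}}\,\|f\|_{L^p(\overline M)} .$$ -/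

import Mathlib

open MeasureTheory
open scoped ENNReal NNReal Manifold ContDiff ComplexConjugate LinearPMap

/-- `μ` is a measure on the manifold `M` given by a smooth volume form: in local coordinates it is
`|g(y)| dy₁ ⋯ dyₙ` for a smooth real function `g` (the coefficient of the form; smooth up to the
boundary). Taking `I = 𝓡∂ n` gives manifolds with boundary, `I = 𝓡 n` those without boundary. -/
def IsSmoothDensity {n : ℕ} {H : Type*} [TopologicalSpace H]
    (I : ModelWithCorners ℝ (EuclideanSpace ℝ (Fin n)) H)
    {M : Type*} [TopologicalSpace M] [ChartedSpace H M] [MeasurableSpace M]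
    (μ : Measure M) : Prop :=
  ∀ x₀ : M, ∃ g : EuclideanSpace ℝ (Fin n) → ℝ,
    ContDiffOn ℝ ∞ g (extChartAt I x₀).target ∧
    ∀ s : Set M, MeasurableSet s → s ⊆ (extChartAt I x₀).source →
      μ s = ∫⁻ y in (extChartAt I x₀) '' s, ENNReal.ofReal |g y|

/-- `u` is a Riesz basis of `L²(μ)`: every `f ∈ L²(μ)` is the sum of a unique series `∑ a_ξ u_ξ`,
convergent in `L²(μ)`. The index set carries no order, so convergence is unordered
(unconditional). -/
def IsRieszBasis {M : Type*} [MeasurableSpace M] {μ : Measure M} {ι : Type*}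
    (u : ι → Lp ℂ 2 μ) : Prop :=
  ∀ f : Lp ℂ 2 μ, ∃! a : ι → ℂ, HasSum (fun ξ => a ξ • u ξ) f

/-- `u` and `v` are the biorthogonal systems of eigenfunctions of the operator `L` on `L²(μ)` and
of its adjoint `L†`. The boundary conditions that accompany `L` are encoded in its domain. Only
`u` is normalised: the norms of the `v ξ` are then determined by biorthogonality. -/
structure IsBiorthogonalEigensystem {M : Type*} [MeasurableSpace M] {μ : Measure M} {ι : Type*}
    (L : Lp ℂ 2 μ →ₗ.[ℂ] Lp ℂ 2 μ) (lam : ι → ℂ) (u v : ι → Lp ℂ 2 μ) : Prop where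
  dense_domain : Dense (L.domain : Set (Lp ℂ 2 μ))
  eigen : ∀ ξ, ∃ h : u ξ ∈ L.domain, L ⟨u ξ, h⟩ = lam ξ • u ξ
  eigen_adjoint : ∀ ξ, ∃ h : v ξ ∈ L†.domain, L† ⟨v ξ, h⟩ = conj (lam ξ) • v ξ
  norm_eq_one : ∀ ξ, ‖u ξ‖ = 1
  biorthogonal_self : ∀ ξ, ∫ x, u ξ x * conj (v ξ x) ∂μ = 1
  biorthogonal_ne : ∀ ξ η, ξ ≠ η → ∫ x, u ξ x * conj (v η x) ∂μ = 0
  rieszBasis : IsRieszBasis u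

/-- The `L`-Fourier transform `(𝓕_L f)(ξ) = ∫ f(x) conj(v_ξ(x)) dx`. -/
noncomputable def LFourier {M : Type*} [MeasurableSpace M] {μ : Measure M} {ι : Type*}
    (v : ι → Lp ℂ 2 μ) (f : M → ℂ) (ξ : ι) : ℂ :=
  ∫ x, f x * conj (v ξ x) ∂μ

/-- The `L^∞` norm (essential supremum) of an `L²` function, possibly `∞`. -/
noncomputable def supNorm {M : Type*} [MeasurableSpace M] {μ : Measure M}
    (w : Lp ℂ 2 μ) : ℝ≥0∞ :=
  eLpNorm w ∞ μ

/-- `M_φ = sup_{t > 0} t ∑_{ξ : t ≤ φ(ξ)} ‖u_ξ‖_∞²`, possibly `∞`. -/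
noncomputable def paleyConst {M : Type*} [MeasurableSpace M] {μ : Measure M} {ι : Type*}
    (u : ι → Lp ℂ 2 μ) (φ : ι → ℝ) : ℝ≥0∞ :=
  ⨆ t : {t : ℝ // 0 < t},
    ENNReal.ofReal t * ∑' ξ : {ξ : ι // (t : ℝ) ≤ φ ξ}, supNorm (u ξ) ^ 2

/-!
Let `F f ξ = ∫ f conj(v_ξ)` be the `L`-Fourier transform. Only two facts about `F` are needed.

* An `L² → ℓ²` bound (`IsBiorthogonalEigensystem.exists_bessel`). Biorthogonality identifies the
  coefficients of the Riesz expansion of `f` as `⟪v_ξ, f⟫`. Unconditional convergence bounds the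
  partial sum operators pointwise, hence uniformly by Banach–Steinhaus. Some choice of signs in
  `∑ ± ⟪v_ξ, f⟫ u_ξ` has squared norm at least `∑ |⟪v_ξ, f⟫|²`, because `‖u_ξ‖ = 1`, and a signed
  sum is a difference of two partial sums.
* The trivial `L¹` bound `|F f ξ| ≤ ‖v_ξ‖_∞ ‖f‖₁`.

If `‖v_ξ‖_∞ ≤ K W_ξ`, the map `f ↦ (|F f ξ| / (φ_ξ W_ξ))_ξ` is of weak type `(1, 1)` and of strong
type `(2, 2)` for the weights `φ_ξ² W_ξ²` on the index set. The Marcinkiewicz argument, with `f` cut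
at height `m t` when the level is `t`, gives Paley's inequality
`∑ |F f|^p (φ W)^(2 - p) ≤ D m^(2 - p) ‖f‖_p^p` with `m` any bound for
`sup_t t ∑_{t ≤ φ} W²` (`exists_paley_bound`).

The Hausdorff–Young inequality `∑ |F f|^q ‖v‖_∞^(2 - q) ≤ D ‖f‖_p^q` for the conjugate exponent `q`
follows from Paley's inequality, without complex interpolation (`exists_hausdorffYoung_bound`): take
`W = ‖v‖_∞` and `φ = (|F f| / ‖v‖_∞)^q` on a finite set of indices. The left side of Paley's
inequality is then the sum `S` to be estimated, and by Chebyshev `S` is an admissible `m`, so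
`S ≤ D S^(2 - p) ‖f‖_p^p`.

For `b = a p + c q` with `a + c = 1`, every exponent in the summand is affine in `b`, so the summand
is the `a`-th power of the Paley summand times the `c`-th power of the Hausdorff–Young summand
(`hausdorffYoungPaley_term_eq`). Hölder's inequality for sums concludes.
-/

/-! ### The `L²` bound for the coefficients of a Riesz basis -/

/-- Some choice of signs, `+` on `t` and `-` off `t`, makes the squared norm of a signed sum at
least the sum of the squared norms: by the parallelogram law, the sign of each new vector can be
chosen so that the squared norm grows by at least the square of the norm of that vector. -/
theorem exists_subset_sum_norm_sq_le {E : Type*} [NormedAddCommGroup E] [InnerProductSpace ℂ E]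
    {ι : Type*} [DecidableEq ι] (x : ι → E) (s : Finset ι) :
    ∃ t ⊆ s, ∑ i ∈ s, ‖x i‖ ^ 2 ≤ ‖∑ i ∈ t, x i - ∑ i ∈ s \ t, x i‖ ^ 2 := by
  induction s using Finset.induction_on with
  | empty => exact ⟨∅, by simp⟩
  | insert j s hj ih =>
    obtain ⟨t, hts, ht⟩ := ih
    have hjt : j ∉ t := fun h => hj (hts h)
    set y := ∑ i ∈ t, x i - ∑ i ∈ s \ t, x i with hy
    have hpar : ‖y + x j‖ ^ 2 + ‖y - x j‖ ^ 2 = 2 * (‖y‖ ^ 2 + ‖x j‖ ^ 2) := by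
      have := parallelogram_law_with_norm ℂ y (x j)
      nlinarith
    rw [Finset.sum_insert hj]
    rcases le_total (‖y - x j‖ ^ 2) (‖y + x j‖ ^ 2) with h | h
    · refine ⟨insert j t, Finset.insert_subset_insert _ hts, ?_⟩
      have e : insert j s \ insert j t = s \ t := by grind
      rw [Finset.sum_insert hjt, e, add_sub_assoc, ← hy, add_comm (x j) y]
      linarith
    · refine ⟨t, hts.trans (Finset.subset_insert _ _), ?_⟩
      have e : insert j s \ t = insert j (s \ t) := by grind
      rw [e, Finset.sum_insert (by grind), add_comm (x j), ← sub_sub, ← hy]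
      linarith

/-- A Bessel inequality for the coefficient functionals of an unconditionally convergent expansion
along unit vectors; the `u i` need not be orthogonal. -/
theorem exists_bessel_bound {E : Type*} [NormedAddCommGroup E] [InnerProductSpace ℂ E]
    [CompleteSpace E] {ι : Type*} {u v : ι → E} (hu : ∀ i, ‖u i‖ = 1)
    (hsum : ∀ f, HasSum (fun i => inner ℂ (v i) f • u i) f) :
    ∃ B : ℝ≥0, ∀ (s : Finset ι) (f : E), ∑ i ∈ s, ‖inner ℂ (v i) f‖ ^ 2 ≤ B * ‖f‖ ^ 2 := by
  classical
  let P : Finset ι → E →L[ℂ] E := fun s =>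
    ∑ i ∈ s, (innerSL ℂ (v i)).smulRight (u i)
  have hP : ∀ s f, P s f = ∑ i ∈ s, inner ℂ (v i) f • u i := by
    intro s f
    simp [P]
  -- Outside a finite set `s₀`, every partial sum has norm less than `1`.
  have hbdd : ∀ f, ∃ C, ∀ s, ‖P s f‖ ≤ C := by
    intro f
    obtain ⟨s₀, hs₀⟩ := summable_iff_vanishing_norm.1 (hsum f).summable 1 one_pos
    refine ⟨∑ i ∈ s₀, ‖inner ℂ (v i) f • u i‖ + 1, fun s => ?_⟩
    rw [hP, ← Finset.sum_inter_add_sum_sdiff s s₀]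
    refine (norm_add_le _ _).trans (add_le_add ?_ (hs₀ _ Finset.sdiff_disjoint).le)
    refine (norm_sum_le _ _).trans ?_
    exact Finset.sum_le_sum_of_subset_of_nonneg Finset.inter_subset_right
      fun _ _ _ => norm_nonneg _
  obtain ⟨K, hK⟩ := banach_steinhaus hbdd
  have hK0 : 0 ≤ K := (norm_nonneg _).trans (hK ∅)
  refine ⟨⟨(2 * K) ^ 2, by positivity⟩, fun s f => ?_⟩
  obtain ⟨t, -, ht⟩ := exists_subset_sum_norm_sq_le (fun i => inner ℂ (v i) f • u i) s
  simp only [norm_smul, hu, mul_one] at ht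
  refine ht.trans ?_
  rw [← hP, ← hP]
  change _ ≤ (2 * K) ^ 2 * ‖f‖ ^ 2
  rw [← mul_pow]
  gcongr
  have h := fun s => (P s).le_of_opNorm_le (hK s) f
  calc _ ≤ ‖P t f‖ + ‖P (s \ t) f‖ := norm_sub_le _ _
    _ ≤ 2 * K * ‖f‖ := by linarith [h t, h (s \ t)]

theorem L2_inner_eq_integral {M : Type*} [MeasurableSpace M] {μ : Measure M}
    (f g : Lp ℂ 2 μ) : inner ℂ f g = ∫ x, g x * conj (f x) ∂μ := by
  rw [L2.inner_def]
  simp [RCLike.inner_apply]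

theorem IsBiorthogonalEigensystem.exists_bessel {M : Type*} [MeasurableSpace M] {μ : Measure M}
    {ι : Type*} {L : Lp ℂ 2 μ →ₗ.[ℂ] Lp ℂ 2 μ} {lam : ι → ℂ} {u v : ι → Lp ℂ 2 μ}
    (h : IsBiorthogonalEigensystem L lam u v) :
    ∃ B : ℝ≥0, ∀ (s : Finset ι) (g : M → ℂ), MemLp g 2 μ →
      ∑ ξ ∈ s, ‖LFourier v g ξ‖ₑ ^ 2 ≤ B * ∫⁻ x, ‖g x‖ₑ ^ 2 ∂μ := by
  classical
  have hsum : ∀ f, HasSum (fun ξ => inner ℂ (v ξ) f • u ξ) f := by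
    intro f
    obtain ⟨a, ha, -⟩ := h.rieszBasis f
    convert ha using 3 with ξ
    -- Pairing the expansion of `f` with `v ξ` leaves only its `ξ`-th coefficient.
    have h1 := ha.mapL (innerSL ℂ (v ξ))
    have h2 : HasSum (fun η => innerSL ℂ (v ξ) (a η • u η)) (a ξ) := by
      convert hasSum_ite_eq ξ (a ξ) using 2 with η
      rw [map_smul, innerSL_apply_apply, L2_inner_eq_integral]
      split_ifs with e
      · rw [e, h.biorthogonal_self]; simp
      · rw [h.biorthogonal_ne _ _ e]; simp
    exact h1.unique h2
  obtain ⟨B, hB⟩ := exists_bessel_bound h.norm_eq_one hsum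
  refine ⟨B, fun s g hg => ?_⟩
  have hF : ∀ ξ, LFourier v g ξ = inner ℂ (v ξ) (hg.toLp g) := by
    intro ξ
    rw [L2_inner_eq_integral]
    refine integral_congr_ae ?_
    filter_upwards [hg.coeFn_toLp] with x hx
    rw [hx]
  have hn : ENNReal.ofReal (‖hg.toLp g‖ ^ 2) = ∫⁻ x, ‖g x‖ₑ ^ 2 ∂μ := by
    rw [ENNReal.ofReal_pow (norm_nonneg _), ofReal_norm, Lp.enorm_toLp,
      eLpNorm_eq_lintegral_rpow_enorm_toReal (by simp) (by simp), ← ENNReal.rpow_natCast,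
      ← ENNReal.rpow_mul]
    simp
  have := ENNReal.ofReal_le_ofReal (hB s (hg.toLp g))
  rw [ENNReal.ofReal_sum_of_nonneg (fun _ _ => by positivity),
    ENNReal.ofReal_mul (by positivity), hn] at this
  simpa [hF, ENNReal.ofReal_pow] using this

/-! ### Distributional estimates -/

theorem lintegral_Ioc_two_mul {w : ℝ} (hw : 0 ≤ w) :
    ∫⁻ t in Set.Ioc 0 w, ENNReal.ofReal (2 * t) = ENNReal.ofReal w ^ 2 := by
  rw [← ofReal_integral_eq_lintegral_ofReal, ← intervalIntegral.integral_of_le hw,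
    intervalIntegral.integral_const_mul, integral_id, ← ENNReal.ofReal_pow hw]
  · congr 1; ring
  · exact ((continuous_const.mul continuous_id).integrableOn_Icc).mono_set Set.Ioc_subset_Icc_self
  · filter_upwards [ae_restrict_mem measurableSet_Ioc] with t ht
    have := ht.1
    simp only [Pi.zero_apply]; linarith

/-- If the weights `W²` have weak-type bound `∑_{t ≤ φ} W² ≤ M / t`, then the sum of `φ² W²` over
`{φ ≤ w}` is at most `2 w M`: write `φ² = ∫_0^φ 2 t dt` and exchange sum and integral. This is what
turns the `L¹` bound for the Fourier coefficients into a weak `(1, 1)` estimate. -/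
theorem sum_filter_le_sq_mul_le {ι : Type*} (s : Finset ι) {φ : ι → ℝ} (hφ : ∀ ξ ∈ s, 0 ≤ φ ξ)
    (W : ι → ℝ≥0∞) {M : ℝ≥0∞}
    (hM : ∀ t : ℝ, 0 < t → ENNReal.ofReal t * ∑ ξ ∈ s with t ≤ φ ξ, W ξ ^ 2 ≤ M)
    {w : ℝ} :
    ∑ ξ ∈ s with φ ξ ≤ w, ENNReal.ofReal (φ ξ) ^ 2 * W ξ ^ 2 ≤ 2 * ENNReal.ofReal w * M := by
  have key : ∀ ξ ∈ s.filter (φ · ≤ w), ENNReal.ofReal (φ ξ) ^ 2 * W ξ ^ 2 =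
      ∫⁻ t in Set.Ioc 0 w, (Set.Iic (φ ξ)).indicator
        (fun t => ENNReal.ofReal (2 * t) * W ξ ^ 2) t := by
    intro ξ hξ
    rw [Finset.mem_filter] at hξ
    rw [lintegral_indicator measurableSet_Iic, Measure.restrict_restrict measurableSet_Iic,
      Set.inter_comm, Set.Ioc_inter_Iic, min_eq_right hξ.2, lintegral_mul_const _ (by fun_prop),
      lintegral_Ioc_two_mul (hφ ξ hξ.1)]
  rw [Finset.sum_congr rfl key, ← lintegral_finsetSum _ (fun ξ _ =>
    Measurable.indicator (by fun_prop) measurableSet_Iic)]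
  calc ∫⁻ t in Set.Ioc 0 w, ∑ ξ ∈ s with φ ξ ≤ w, (Set.Iic (φ ξ)).indicator
        (fun t => ENNReal.ofReal (2 * t) * W ξ ^ 2) t
      ≤ ∫⁻ t in Set.Ioc 0 w, 2 * M := by
        refine setLIntegral_mono measurable_const fun t ht => ?_
        calc _ ≤ ∑ ξ ∈ s, (Set.Iic (φ ξ)).indicator
                (fun t => ENNReal.ofReal (2 * t) * W ξ ^ 2) t :=
              Finset.sum_le_sum_of_subset (Finset.filter_subset _ _)
          _ = 2 * (ENNReal.ofReal t * ∑ ξ ∈ s with t ≤ φ ξ, W ξ ^ 2) := by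
              rw [Finset.sum_filter, Finset.mul_sum, Finset.mul_sum]
              refine Finset.sum_congr rfl fun ξ _ => ?_
              by_cases h : t ≤ φ ξ
              · simp [h, ENNReal.ofReal_mul, mul_assoc]
              · simp [h]
          _ ≤ 2 * M := by gcongr; exact hM t ht.1
    _ = 2 * ENNReal.ofReal w * M := by
        rw [setLIntegral_const, Real.volume_Ioc, sub_zero]; ring

theorem lintegral_Ioo_rpow {a y : ℝ} (ha : -1 < a) (hy : 0 ≤ y) :
    ∫⁻ t in Set.Ioo 0 y, ENNReal.ofReal (t ^ a) = ENNReal.ofReal (y ^ (a + 1) / (a + 1)) := by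
  rw [Measure.restrict_congr_set Ioo_ae_eq_Ioc, ← ofReal_integral_eq_lintegral_ofReal, 
    ← intervalIntegral.integral_of_le hy, integral_rpow (Or.inl ha),
    Real.zero_rpow (by linarith), sub_zero]
  · exact (intervalIntegrable_iff_integrableOn_Ioc_of_le hy).1
      (intervalIntegral.intervalIntegrable_rpow' ha)
  · filter_upwards [ae_restrict_mem measurableSet_Ioc] with t ht
    exact Real.rpow_nonneg ht.1.le _

theorem lintegral_Ici_rpow {a y : ℝ} (ha : a < -1) (hy : 0 < y) :
    ∫⁻ t in Set.Ici y, ENNReal.ofReal (t ^ a) = ENNReal.ofReal (-y ^ (a + 1) / (a + 1)) := by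
  rw [Measure.restrict_congr_set Ioi_ae_eq_Ici.symm, ← ofReal_integral_eq_lintegral_ofReal,
    integral_Ioi_rpow_of_lt ha hy]
  · exact integrableOn_Ioi_rpow_of_lt ha hy
  · filter_upwards [ae_restrict_mem measurableSet_Ioi] with t ht
    exact Real.rpow_nonneg (hy.trans ht).le _

/-- Layer-cake formula for `(a / c) ^ p`, multiplied by `c ^ 2`. -/
theorem rpow_mul_rpow_eq_lintegral {p : ℝ} (hp : 0 < p) {a c : ℝ≥0∞} (ha : a ≠ ⊤) (hc : c ≠ 0)
    (hc' : c ≠ ⊤) :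
    a ^ p * c ^ (2 - p) = ∫⁻ t in Set.Ioi (0 : ℝ),
      ENNReal.ofReal (p * t ^ (p - 1)) * (if ENNReal.ofReal t * c < a then c ^ 2 else 0) := by
  have hdiv : a / c ≠ ⊤ := ENNReal.div_ne_top ha hc
  have e : ∀ t ∈ Set.Ioi (0 : ℝ),
      ENNReal.ofReal (p * t ^ (p - 1)) * (if ENNReal.ofReal t * c < a then c ^ 2 else 0) =
      (Set.Iio (a / c).toReal).indicator
        (fun t => ENNReal.ofReal p * c ^ 2 * ENNReal.ofReal (t ^ (p - 1))) t := by
    intro t ht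
    have h : ENNReal.ofReal t * c < a ↔ t < (a / c).toReal := by
      rw [← ENNReal.lt_div_iff_mul_lt (Or.inl hc) (Or.inl hc'),
        ENNReal.ofReal_lt_iff_lt_toReal (le_of_lt ht) hdiv]
    by_cases h' : t < (a / c).toReal
    · simp only [h, h', if_true, Set.indicator, Set.mem_Iio]
      rw [ENNReal.ofReal_mul hp.le]; ring
    · simp only [h, h', if_false, Set.indicator, Set.mem_Iio, mul_zero]
  rw [setLIntegral_congr_fun measurableSet_Ioi e, lintegral_indicator measurableSet_Iio,
    Measure.restrict_restrict measurableSet_Iio, Set.inter_comm, Set.Ioi_inter_Iio,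
    lintegral_const_mul _ (by fun_prop),
    lintegral_Ioo_rpow (by linarith) ENNReal.toReal_nonneg, sub_add_cancel,
    ENNReal.ofReal_div_of_pos hp, ← ENNReal.ofReal_rpow_of_nonneg ENNReal.toReal_nonneg hp.le,
    ENNReal.ofReal_toReal hdiv, ENNReal.div_rpow_of_nonneg _ _ hp.le,
    ENNReal.rpow_sub _ _ hc hc', ENNReal.rpow_two]
  have hp0 : ENNReal.ofReal p ≠ 0 := by simpa using hp
  simp only [div_eq_mul_inv]
  calc _ = (ENNReal.ofReal p * (ENNReal.ofReal p)⁻¹) * (a ^ p * (c ^ 2 * (c ^ p)⁻¹)) := by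
        rw [ENNReal.mul_inv_cancel hp0 ENNReal.ofReal_ne_top, one_mul]
    _ = _ := by ring

/-- Tonelli's theorem for functions of `‖f x‖` that vanish where `f` does. No σ-finiteness of `μ` is
needed, since an `L^q` function vanishes almost everywhere off a σ-finite set. -/
theorem lintegral_lintegral_comp_norm {M : Type*} [MeasurableSpace M] {μ : Measure M}
    {ν : Measure ℝ} [SFinite ν]
    {f : M → ℂ} {q : ℝ≥0∞} (hf : MemLp f q μ) (hq : q ≠ 0) (hq' : q ≠ ⊤)
    {G : ℝ → ℝ → ℝ≥0∞} (hG : Measurable (Function.uncurry G)) (hG0 : ∀ t, G t 0 = 0) :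
    ∫⁻ t, ∫⁻ x, G t ‖f x‖ ∂μ ∂ν = ∫⁻ x, ∫⁻ t, G t ‖f x‖ ∂ν ∂μ := by
  obtain ⟨g, hg, hfg⟩ := hf.1
  have hgp : MemLp g q μ := hf.ae_eq hfg
  obtain ⟨T, hT, hgT, hσ⟩ :=
    (hgp.finStronglyMeasurable_of_stronglyMeasurable hg hq hq').exists_set_sigmaFinite
  have h1 : ∀ t, ∫⁻ x, G t ‖f x‖ ∂μ = ∫⁻ x in T, G t ‖g x‖ ∂μ := by
    intro t
    rw [lintegral_congr_ae (hfg.mono fun x hx => by simp only [hx] :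
      (fun x => G t ‖f x‖) =ᵐ[μ] fun x => G t ‖g x‖)]
    refine (setLIntegral_eq_of_support_subset ?_).symm
    intro x hx
    by_contra hxT
    exact hx (by simp [hgT x hxT, hG0])
  have h2 : ∫⁻ x, ∫⁻ t, G t ‖f x‖ ∂ν ∂μ = ∫⁻ x in T, ∫⁻ t, G t ‖g x‖ ∂ν ∂μ := by
    rw [lintegral_congr_ae (hfg.mono fun x hx => by simp only [hx] :
      (fun x => ∫⁻ t, G t ‖f x‖ ∂ν) =ᵐ[μ] fun x => ∫⁻ t, G t ‖g x‖ ∂ν)]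
    refine (setLIntegral_eq_of_support_subset ?_).symm
    intro x hx
    by_contra hxT
    exact hx (by simp [hgT x hxT, hG0])
  simp only [h1, h2]
  refine lintegral_lintegral_swap (Measurable.aemeasurable ?_)
  exact hG.comp (measurable_fst.prodMk (hg.norm.measurable.comp measurable_snd))

/-! ### Truncations and the `L¹` bound -/

/-- The part of `f` where `‖f‖ > h`. -/
noncomputable def highPart {M : Type*} (f : M → ℂ) (h : ℝ) : M → ℂ :=
  {x | h < ‖f x‖}.indicator f

/-- The part of `f` where `‖f‖ ≤ h`. -/
noncomputable def lowPart {M : Type*} (f : M → ℂ) (h : ℝ) : M → ℂ :=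
  {x | h < ‖f x‖}ᶜ.indicator f

theorem highPart_add_lowPart {M : Type*} (f : M → ℂ) (h : ℝ) : highPart f h + lowPart f h = f :=
  Set.indicator_self_add_compl _ _

section
variable {M : Type*} [MeasurableSpace M] {μ : Measure M}

theorem memLp_of_norm_rpow_le {f g : M → ℂ} {p q : ℝ} (hp : 0 < p) (hq : 0 < q)
    (hf : MemLp f (ENNReal.ofReal p) μ) (hg : AEStronglyMeasurable g μ) (C : ℝ)
    (h : ∀ x, ‖g x‖ ^ q ≤ C * ‖f x‖ ^ p) : MemLp g (ENNReal.ofReal q) μ := by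
  rw [← integrable_norm_rpow_iff hg (by simpa using hq) (by simp), ENNReal.toReal_ofReal hq.le]
  have hfi := hf.integrable_norm_rpow (by simpa using hp) (by simp)
  rw [ENNReal.toReal_ofReal hp.le] at hfi
  refine (hfi.const_mul C).mono' (hg.norm.aemeasurable.pow_const q).aestronglyMeasurable ?_
  filter_upwards with x
  rw [Real.norm_of_nonneg (by positivity)]
  exact h x

theorem memLp_highPart {f : M → ℂ} {p h : ℝ} (hp : 1 < p) (hh : 0 < h)
    (hf : MemLp f (ENNReal.ofReal p) μ) : MemLp (highPart f h) 1 μ := by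
  have hm : AEStronglyMeasurable (highPart f h) μ :=
    hf.1.indicator₀ (nullMeasurableSet_lt aemeasurable_const hf.1.norm.aemeasurable)
  rw [← ENNReal.ofReal_one]
  refine memLp_of_norm_rpow_le (by linarith) one_pos hf hm (h ^ (1 - p)) fun x => ?_
  by_cases hx : h < ‖f x‖
  · have h0 : 0 < ‖f x‖ := hh.trans hx
    have : highPart f h x = f x := Set.indicator_of_mem (s := {x | h < ‖f x‖}) hx f
    rw [this]
    calc ‖f x‖ ^ (1 : ℝ) = ‖f x‖ ^ (1 - p) * ‖f x‖ ^ p := by rw [← Real.rpow_add h0]; simp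
      _ ≤ _ := by
        gcongr ?_ * _
        exact Real.rpow_le_rpow_of_nonpos hh hx.le (by linarith)
  · have : highPart f h x = 0 := Set.indicator_of_notMem (s := {x | h < ‖f x‖}) hx f
    rw [this]; simp; positivity

theorem memLp_lowPart {f : M → ℂ} {p h : ℝ} (hp : 1 < p) (hp2 : p ≤ 2) (hh : 0 < h)
    (hf : MemLp f (ENNReal.ofReal p) μ) : MemLp (lowPart f h) 2 μ := by
  have hm : AEStronglyMeasurable (lowPart f h) μ :=
    hf.1.indicator₀ (nullMeasurableSet_lt aemeasurable_const hf.1.norm.aemeasurable).compl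
  have e2 : (2 : ℝ≥0∞) = ENNReal.ofReal 2 := by simp
  rw [e2]
  refine memLp_of_norm_rpow_le (by linarith) two_pos hf hm (h ^ (2 - p)) fun x => ?_
  by_cases hx : h < ‖f x‖
  · have : lowPart f h x = 0 := Set.indicator_of_notMem (s := {x | h < ‖f x‖}ᶜ) (not_not.2 hx) f
    rw [this, norm_zero, Real.zero_rpow two_ne_zero]
    positivity
  · have : lowPart f h x = f x := Set.indicator_of_mem (s := {x | h < ‖f x‖}ᶜ) hx f
    rw [this]
    calc ‖f x‖ ^ (2 : ℝ) = ‖f x‖ ^ (2 - p) * ‖f x‖ ^ p := by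
          rw [← Real.rpow_add_of_nonneg (norm_nonneg _) (by linarith) (by linarith)]; simp
      _ ≤ _ := by
        gcongr ?_ * _
        exact Real.rpow_le_rpow (norm_nonneg _) (not_lt.1 hx) (by linarith)

variable {ι : Type*} {v : ι → Lp ℂ 2 μ}

theorem integrable_mul_conj_of_memLp_one {g : M → ℂ} (hg : MemLp g 1 μ) {w : Lp ℂ 2 μ}
    (hw : supNorm w ≠ ⊤) : Integrable (fun x => g x * conj (w x)) μ := by
  have hw' : MemLp (fun x => conj (w x)) ∞ μ :=
    MemLp.star ⟨(Lp.memLp w).1, lt_top_iff_ne_top.2 hw⟩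
  exact memLp_one_iff_integrable.1 (hw'.mul hg (p := 1))

theorem integrable_mul_conj_of_memLp_two {g : M → ℂ} (hg : MemLp g 2 μ) (w : Lp ℂ 2 μ) :
    Integrable (fun x => g x * conj (w x)) μ :=
  memLp_one_iff_integrable.1 ((Lp.memLp w).star.mul hg)

theorem integrable_mul_conj {f : M → ℂ} {p : ℝ} (hp : 1 < p) (hp2 : p ≤ 2)
    (hf : MemLp f (ENNReal.ofReal p) μ) {w : Lp ℂ 2 μ}
    (hw : supNorm w ≠ ⊤) : Integrable (fun x => f x * conj (w x)) μ := by
  have := (integrable_mul_conj_of_memLp_one (memLp_highPart hp one_pos hf) hw).add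
    (integrable_mul_conj_of_memLp_two (memLp_lowPart hp hp2 one_pos hf) w)
  refine this.congr (Filter.Eventually.of_forall fun x => ?_)
  change highPart f 1 x * _ + lowPart f 1 x * _ = _
  rw [← add_mul, ← Pi.add_apply, highPart_add_lowPart]

theorem enorm_LFourier_le (g : M → ℂ) {ξ : ι} (hw : supNorm (v ξ) ≠ ⊤) :
    ‖LFourier v g ξ‖ₑ ≤ supNorm (v ξ) * ∫⁻ x, ‖g x‖ₑ ∂μ := by
  refine (enorm_integral_le_lintegral_enorm _).trans ?_
  rw [← lintegral_const_mul' _ _ hw]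
  refine lintegral_mono_ae ?_
  filter_upwards [enorm_ae_le_eLpNormEssSup (v ξ) μ] with x hx
  rw [enorm_mul, mul_comm, RCLike.enorm_conj, supNorm, eLpNorm_exponent_top]
  gcongr

theorem enorm_LFourier_le_add {f : M → ℂ} {p h : ℝ} (hp : 1 < p) (hp2 : p ≤ 2) (hh : 0 < h)
    (hf : MemLp f (ENNReal.ofReal p) μ) {ξ : ι} (hw : supNorm (v ξ) ≠ ⊤) :
    ‖LFourier v f ξ‖ₑ ≤ ‖LFourier v (highPart f h) ξ‖ₑ + ‖LFourier v (lowPart f h) ξ‖ₑ := by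
  have : LFourier v f ξ = LFourier v (highPart f h) ξ + LFourier v (lowPart f h) ξ := by
    unfold LFourier
    rw [← integral_add (integrable_mul_conj_of_memLp_one (memLp_highPart hp hh hf) hw)
      (integrable_mul_conj_of_memLp_two (memLp_lowPart hp hp2 hh hf) _)]
    refine integral_congr_ae (Filter.Eventually.of_forall fun x => ?_)
    change _ = highPart f h x * _ + lowPart f h x * _
    rw [← add_mul, ← Pi.add_apply, highPart_add_lowPart]
  rw [this]
  exact enorm_add_le _ _
end

/-! ### Paley's inequality -/

section
variable {M : Type*} [MeasurableSpace M] {μ : Measure M} {ι : Type*} {v : ι → Lp ℂ 2 μ}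

/-- The weak-type estimate at level `t` behind Paley's inequality. Where `|F f|` exceeds `t φ W`,
one of the two parts of `f` has a coefficient of size at least `t φ W / 2`. For the high part this
forces `φ ≤ 2 K ‖highPart f h‖₁ / t`; the low part is handled by Chebyshev and the `L²` bound. -/
theorem sum_level_le {B K : ℝ≥0} {s : Finset ι}
    (hB : ∀ g : M → ℂ, MemLp g 2 μ →
      ∑ ξ ∈ s, ‖LFourier v g ξ‖ₑ ^ 2 ≤ B * ∫⁻ x, ‖g x‖ₑ ^ 2 ∂μ)
    {W : ι → ℝ≥0∞} (hW : ∀ ξ ∈ s, W ξ ≠ ⊤)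
    (hvW : ∀ ξ ∈ s, supNorm (v ξ) ≤ K * W ξ)
    {φ : ι → ℝ} (hφ : ∀ ξ ∈ s, 0 < φ ξ) {m : ℝ≥0}
    (hM : ∀ t : ℝ, 0 < t → ENNReal.ofReal t * ∑ ξ ∈ s with t ≤ φ ξ, W ξ ^ 2 ≤ m)
    {p : ℝ} (hp : 1 < p) (hp2 : p ≤ 2) {f : M → ℂ} (hf : MemLp f (ENNReal.ofReal p) μ)
    {h : ℝ} (hh : 0 < h) {t : ℝ} (ht : 0 < t) :
    ∑ ξ ∈ s, (if ENNReal.ofReal t * (ENNReal.ofReal (φ ξ) * W ξ) < ‖LFourier v f ξ‖ₑ then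
        (ENNReal.ofReal (φ ξ) * W ξ) ^ 2 else 0) ≤
      ENNReal.ofReal (4 * K * m / t) * ∫⁻ x, ‖highPart f h x‖ₑ ∂μ +
      ENNReal.ofReal (4 * B / t ^ 2) * ∫⁻ x, ‖lowPart f h x‖ₑ ^ 2 ∂μ := by
  have hv : ∀ ξ ∈ s, supNorm (v ξ) ≠ ⊤ := fun ξ hξ =>
    ne_top_of_le_ne_top (ENNReal.mul_ne_top ENNReal.coe_ne_top (hW ξ hξ)) (hvW ξ hξ)
  have hN : ∫⁻ x, ‖highPart f h x‖ₑ ∂μ ≠ ⊤ := by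
    have := (memLp_highPart hp hh hf).2
    rw [eLpNorm_one_eq_lintegral_enorm] at this
    exact this.ne
  set N := (∫⁻ x, ‖highPart f h x‖ₑ ∂μ).toReal
  have hNe : ∫⁻ x, ‖highPart f h x‖ₑ ∂μ = ENNReal.ofReal N := (ENNReal.ofReal_toReal hN).symm
  have hN0 : 0 ≤ N := ENNReal.toReal_nonneg
  calc _ ≤ ∑ ξ ∈ s, ((if φ ξ ≤ 2 * K * N / t then ENNReal.ofReal (φ ξ) ^ 2 * W ξ ^ 2 else 0) +
          ENNReal.ofReal (4 / t ^ 2) * ‖LFourier v (lowPart f h) ξ‖ₑ ^ 2) := by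
        refine Finset.sum_le_sum fun ξ hξ => ?_
        split_ifs with h1 h2 h2
        · rw [mul_pow]; exact le_self_add
        · -- For `φ ξ` this large, the high part cannot reach half the level, so the low part does.
          rw [zero_add]
          have hhigh : ‖LFourier v (highPart f h) ξ‖ₑ ≤
              ENNReal.ofReal (t / 2) * (ENNReal.ofReal (φ ξ) * W ξ) := by
            calc _ ≤ supNorm (v ξ) * ENNReal.ofReal N := hNe ▸ enorm_LFourier_le _ (hv ξ hξ)
              _ ≤ K * W ξ * ENNReal.ofReal N := by gcongr; exact hvW ξ hξ
              _ = ENNReal.ofReal (K * N) * W ξ := by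
                rw [ENNReal.ofReal_mul (NNReal.coe_nonneg K), ENNReal.ofReal_coe_nnreal]; ring
              _ ≤ ENNReal.ofReal (t / 2 * φ ξ) * W ξ := by
                gcongr ENNReal.ofReal ?_ * _
                rw [not_le, div_lt_iff₀ ht] at h2
                linarith
              _ = _ := by rw [ENNReal.ofReal_mul (by positivity), mul_assoc]
          set c := ENNReal.ofReal (φ ξ) * W ξ with hc
          clear_value c
          have hsplit : ENNReal.ofReal t * c =
              ENNReal.ofReal (t / 2) * c + ENNReal.ofReal (t / 2) * c := by
            rw [← add_mul, ← ENNReal.ofReal_add (by positivity) (by positivity), add_halves]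
          have hlow : ENNReal.ofReal (t / 2) * c ≤ ‖LFourier v (lowPart f h) ξ‖ₑ := by
            by_contra! hlt
            refine absurd h1 (not_lt.2 ?_)
            rw [hsplit]
            exact (enorm_LFourier_le_add hp hp2 hh hf (hv ξ hξ)).trans (add_le_add hhigh hlt.le)
          calc c ^ 2 = ENNReal.ofReal (4 / t ^ 2) * (ENNReal.ofReal (t / 2) * c) ^ 2 := by
                rw [mul_pow, ← mul_assoc, ← ENNReal.ofReal_pow (by positivity),
                  ← ENNReal.ofReal_mul (by positivity)]
                have : 4 / t ^ 2 * (t / 2) ^ 2 = 1 := by field_simp; norm_num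
                rw [this]; simp
            _ ≤ _ := by gcongr
        · exact zero_le
        · exact zero_le
    _ ≤ 2 * ENNReal.ofReal (2 * K * N / t) * m +
          ENNReal.ofReal (4 / t ^ 2) * (B * ∫⁻ x, ‖lowPart f h x‖ₑ ^ 2 ∂μ) := by
        rw [Finset.sum_add_distrib, ← Finset.sum_filter, ← Finset.mul_sum]
        gcongr
        · exact sum_filter_le_sq_mul_le s (fun ξ hξ => (hφ ξ hξ).le) W hM
        · exact hB _ (memLp_lowPart hp hp2 hh hf)
    _ = _ := by
        have h4 : ENNReal.ofReal (4 * K * m / t) * ENNReal.ofReal N =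
            2 * ENNReal.ofReal (2 * K * N / t) * m := by
          have e2 : (2 : ℝ≥0∞) = ENNReal.ofReal 2 := by simp
          rw [← ENNReal.ofReal_coe_nnreal (p := m), e2, ← ENNReal.ofReal_mul (by positivity),
            ← ENNReal.ofReal_mul (by positivity), ← ENNReal.ofReal_mul (by positivity)]
          congr 1; ring
        rw [hNe, h4, ← mul_assoc, ← ENNReal.ofReal_coe_nnreal (p := B),
          ← ENNReal.ofReal_mul (by positivity)]
        congr 3; ring

/-- The integrand in the Marcinkiewicz argument, as a function of the level `t` and of the value
`y = ‖f x‖`: the density `p t^(p-1)` of the layer-cake formula times the bound of `sum_level_le`,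
for `f` cut at height `m t`. -/
noncomputable def truncKernel (p c d m t y : ℝ) : ℝ≥0∞ :=
  ENNReal.ofReal (p * t ^ (p - 1)) *
    (ENNReal.ofReal (c / t) * (if m * t < y then ENNReal.ofReal y else 0) +
      ENNReal.ofReal (d / t ^ 2) * (if m * t < y then 0 else ENNReal.ofReal y ^ 2))

theorem measurable_truncKernel (p c d m : ℝ) :
    Measurable (Function.uncurry (truncKernel p c d m)) := by
  unfold truncKernel Function.uncurry
  have hs : MeasurableSet {z : ℝ × ℝ | m * z.1 < z.2} :=
    measurableSet_lt (by fun_prop) (by fun_prop)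
  refine Measurable.mul (by fun_prop) (Measurable.add (Measurable.mul (by fun_prop) ?_)
    (Measurable.mul (by fun_prop) ?_))
  · exact Measurable.ite hs (by fun_prop) (by fun_prop)
  · exact Measurable.ite hs (by fun_prop) (by fun_prop)

theorem lintegral_truncKernel {p c d m y : ℝ} (hp : 1 < p) (hp2 : p < 2) (hc : 0 ≤ c) (hd : 0 ≤ d)
    (hm : 0 < m) (hy : 0 ≤ y) :
    ∫⁻ t in Set.Ioi (0 : ℝ), truncKernel p (c * m) d m t y =
      ENNReal.ofReal ((p * c / (p - 1) + p * d / (2 - p)) * m ^ (2 - p)) *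
        ENNReal.ofReal y ^ p := by
  rcases hy.eq_or_lt with rfl | hy
  · simp [truncKernel, show 0 < p by linarith]
  have e : ∀ t ∈ Set.Ioi (0 : ℝ), truncKernel p (c * m) d m t y =
      (Set.Iio (y / m)).indicator
        (fun t => ENNReal.ofReal (p * c * m * y) * ENNReal.ofReal (t ^ (p - 2))) t +
      (Set.Ici (y / m)).indicator
        (fun t => ENNReal.ofReal (p * d * y ^ 2) * ENNReal.ofReal (t ^ (p - 3))) t := by
    intro t (ht : 0 < t)
    have hiff : m * t < y ↔ t < y / m := by rw [lt_div_iff₀ hm, mul_comm]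
    unfold truncKernel
    by_cases h : t < y / m
    · rw [Set.indicator_of_mem (by exact h), Set.indicator_of_notMem (by simpa using h),
        if_pos (hiff.2 h), if_pos (hiff.2 h), mul_zero, add_zero, add_zero,
        ← ENNReal.ofReal_mul (by positivity), ← ENNReal.ofReal_mul (by positivity),
        ← ENNReal.ofReal_mul (by positivity)]
      have : t ^ (p - 1) = t ^ (p - 2) * t := by
        rw [← Real.rpow_add_one ht.ne']; ring_nf
      rw [this]; congr 1; field_simp
    · rw [Set.indicator_of_notMem (by exact h), Set.indicator_of_mem (by simpa using h),
        if_neg (hiff.not.2 h), if_neg (hiff.not.2 h), mul_zero, zero_add, zero_add,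
        ← ENNReal.ofReal_pow hy.le,
        ← ENNReal.ofReal_mul (by positivity), ← ENNReal.ofReal_mul (by positivity),
        ← ENNReal.ofReal_mul (by positivity)]
      have : t ^ (p - 1) = t ^ (p - 3) * t ^ 2 := by
        rw [← Real.rpow_natCast, ← Real.rpow_add ht]; norm_num; ring_nf
      rw [this]; congr 1; field_simp
  have hym : 0 < y / m := by positivity
  have hI : Set.Ici (y / m) ∩ Set.Ioi 0 = Set.Ici (y / m) :=
    Set.inter_eq_left.2 fun t ht => hym.trans_le ht
  rw [setLIntegral_congr_fun measurableSet_Ioi e,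
    lintegral_add_left (Measurable.indicator (by fun_prop) measurableSet_Iio),
    lintegral_indicator measurableSet_Iio, lintegral_indicator measurableSet_Ici,
    Measure.restrict_restrict measurableSet_Iio, Measure.restrict_restrict measurableSet_Ici,
    Set.inter_comm, Set.Ioi_inter_Iio,
    hI,
    lintegral_const_mul _ (by fun_prop), lintegral_const_mul _ (by fun_prop),
    lintegral_Ioo_rpow (by linarith) hym.le, lintegral_Ici_rpow (by linarith) hym,
    ← ENNReal.ofReal_mul (by positivity), ← ENNReal.ofReal_mul (by positivity),
    ENNReal.ofReal_rpow_of_nonneg hy.le (by linarith)]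
  have h1 : (y / m) ^ (p - 2 + 1) = y ^ p / y * (m ^ (2 - p) / m) := by
    rw [Real.div_rpow hy.le hm.le, show p - 2 + 1 = p - 1 by ring, Real.rpow_sub_one hy.ne',
      div_eq_mul_inv _ (m ^ (p - 1)), ← Real.rpow_neg hm.le, ← Real.rpow_sub_one hm.ne']
    ring_nf
  have h2 : (y / m) ^ (p - 3 + 1) = y ^ p / y ^ 2 * m ^ (2 - p) := by
    rw [Real.div_rpow hy.le hm.le, show p - 3 + 1 = p - 2 by ring, Real.rpow_sub hy,
      div_eq_mul_inv _ (m ^ (p - 2)), ← Real.rpow_neg hm.le, Real.rpow_two]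
    ring_nf
  rw [h1, h2, ← ENNReal.ofReal_add, ← ENNReal.ofReal_mul]
  · congr 1
    have a1 : p - 1 ≠ 0 := by linarith
    have a2 : 2 - p ≠ 0 := by linarith
    have e4 : -(y ^ p / y ^ 2 * m ^ (2 - p)) / (p - 3 + 1) =
        y ^ p / y ^ 2 * m ^ (2 - p) / (2 - p) := by
      rw [show p - 3 + 1 = -(2 - p) by ring, neg_div_neg_eq]
    rw [e4, show p - 2 + 1 = p - 1 by ring]
    field_simp
  · have : 0 < p - 1 := by linarith
    have : 0 < 2 - p := by linarith
    positivity
  · have : 0 < p - 2 + 1 := by linarith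
    positivity
  · have : 0 < 2 - p := by linarith
    rw [show p - 3 + 1 = -(2 - p) by ring, neg_div_neg_eq]
    positivity

/-- Paley's inequality for `1 < p < 2`. The height `m t` of the cut at level `t` makes both terms of
the weak-type estimate contribute the same power `m ^ (2 - p)`. -/
theorem exists_paley_bound_of_lt_two (B K : ℝ≥0) {p : ℝ} (hp : 1 < p) (hp2 : p < 2) :
    ∃ D : ℝ≥0, ∀ s : Finset ι,
    (∀ g : M → ℂ, MemLp g 2 μ →
      ∑ ξ ∈ s, ‖LFourier v g ξ‖ₑ ^ 2 ≤ B * ∫⁻ x, ‖g x‖ₑ ^ 2 ∂μ) →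
    ∀ W : ι → ℝ≥0∞, (∀ ξ ∈ s, W ξ ≠ 0) → (∀ ξ ∈ s, W ξ ≠ ⊤) →
    (∀ ξ ∈ s, supNorm (v ξ) ≤ K * W ξ) →
    ∀ φ : ι → ℝ, (∀ ξ ∈ s, 0 < φ ξ) → ∀ m : ℝ≥0, 0 < m →
    (∀ t : ℝ, 0 < t → ENNReal.ofReal t * ∑ ξ ∈ s with t ≤ φ ξ, W ξ ^ 2 ≤ m) →
    ∀ f : M → ℂ, MemLp f (ENNReal.ofReal p) μ →
    ∑ ξ ∈ s, ‖LFourier v f ξ‖ₑ ^ p * (ENNReal.ofReal (φ ξ) * W ξ) ^ (2 - p) ≤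
      D * (m : ℝ≥0∞) ^ (2 - p) * ∫⁻ x, ‖f x‖ₑ ^ p ∂μ := by
  refine ⟨(p * (4 * K) / (p - 1) + p * (4 * B) / (2 - p)).toNNReal,
    fun s hB W hW hW' hvW φ hφ m hm hM f hf => ?_⟩
  have hm' : (0 : ℝ) < m := hm
  calc _ = ∑ ξ ∈ s, ∫⁻ t in Set.Ioi (0 : ℝ), ENNReal.ofReal (p * t ^ (p - 1)) *
          (if ENNReal.ofReal t * (ENNReal.ofReal (φ ξ) * W ξ) < ‖LFourier v f ξ‖ₑ then
            (ENNReal.ofReal (φ ξ) * W ξ) ^ 2 else 0) := by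
        refine Finset.sum_congr rfl fun ξ hξ => ?_
        refine rpow_mul_rpow_eq_lintegral (by linarith) enorm_ne_top (mul_ne_zero ?_ (hW ξ hξ))
          (ENNReal.mul_ne_top ENNReal.ofReal_ne_top (hW' ξ hξ))
        simpa using hφ ξ hξ
    _ = ∫⁻ t in Set.Ioi (0 : ℝ), ENNReal.ofReal (p * t ^ (p - 1)) * ∑ ξ ∈ s,
          (if ENNReal.ofReal t * (ENNReal.ofReal (φ ξ) * W ξ) < ‖LFourier v f ξ‖ₑ then
            (ENNReal.ofReal (φ ξ) * W ξ) ^ 2 else 0) := by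
        rw [← lintegral_finsetSum]
        · simp_rw [Finset.mul_sum]
        · intro ξ _
          exact Measurable.mul (by fun_prop) (Measurable.ite
            (measurableSet_lt (by fun_prop) measurable_const) measurable_const measurable_const)
    _ ≤ ∫⁻ t in Set.Ioi (0 : ℝ), ∫⁻ x, truncKernel p (4 * K * m) (4 * B) m t ‖f x‖ ∂μ := by
        refine lintegral_mono_ae ?_
        filter_upwards [ae_restrict_mem measurableSet_Ioi] with t (ht : 0 < t)
        have hmeas : NullMeasurableSet {x | m * t < ‖f x‖} μ :=
          nullMeasurableSet_lt aemeasurable_const hf.1.norm.aemeasurable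
        refine (mul_le_mul_right (sum_level_le hB hW' hvW hφ hM hp hp2.le hf
          (mul_pos hm' ht) ht) _).trans_eq ?_
        unfold truncKernel
        rw [lintegral_const_mul' _ _ ENNReal.ofReal_ne_top, lintegral_add_left',
          lintegral_const_mul' _ _ ENNReal.ofReal_ne_top,
          lintegral_const_mul' _ _ ENNReal.ofReal_ne_top]
        · congr 3
          · refine lintegral_congr fun x => ?_
            by_cases h : m * t < ‖f x‖ <;> simp [highPart, Set.indicator, h]
          · refine lintegral_congr fun x => ?_
            by_cases h : m * t < ‖f x‖ <;> simp [lowPart, Set.indicator, h]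
        · have := hf.1.enorm.indicator₀ hmeas
          convert this.const_mul (ENNReal.ofReal (4 * K * m / t)) using 3 with x
          by_cases h : m * t < ‖f x‖ <;> simp [Set.indicator, h]
    _ = ∫⁻ x, ∫⁻ t in Set.Ioi (0 : ℝ), truncKernel p (4 * K * m) (4 * B) m t ‖f x‖ ∂volume ∂μ := by
        refine lintegral_lintegral_comp_norm hf (by simp; linarith) (by simp)
          (measurable_truncKernel _ _ _ _) fun t => ?_
        simp [truncKernel]
    _ = _ := by
        rw [← lintegral_const_mul' _ _ (ENNReal.mul_ne_top ENNReal.coe_ne_top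
          (ENNReal.rpow_ne_top_of_nonneg (by linarith) ENNReal.coe_ne_top))]
        refine lintegral_congr fun x => ?_
        rw [lintegral_truncKernel hp hp2 (by positivity) (by positivity) hm' (norm_nonneg _),
          ENNReal.ofReal_mul, ofReal_norm, ENNReal.ofReal,
          ← ENNReal.ofReal_rpow_of_pos hm', ENNReal.ofReal_coe_nnreal]
        have : 0 < p - 1 := by linarith
        have : 0 < 2 - p := by linarith
        positivity
end

section
variable {M : Type*} [MeasurableSpace M] {μ : Measure M} {ι : Type*} {v : ι → Lp ℂ 2 μ}

theorem lintegral_enorm_rpow_eq {E : Type*} [NormedAddCommGroup E] (f : M → E) {p : ℝ}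
    (hp : 0 < p) :
    ∫⁻ x, ‖f x‖ₑ ^ p ∂μ = eLpNorm f (ENNReal.ofReal p) μ ^ p := by
  rw [eLpNorm_eq_lintegral_rpow_enorm_toReal (by simpa using hp) (by simp),
    ENNReal.toReal_ofReal hp.le, ← ENNReal.rpow_mul, one_div, inv_mul_cancel₀ hp.ne',
    ENNReal.rpow_one]

/-- **Paley's inequality** on finite sets of indices, for `1 < p ≤ 2`; at `p = 2` it is the `L²`
bound. -/
theorem exists_paley_bound (B K : ℝ≥0) {p : ℝ} (hp : 1 < p) (hp2 : p ≤ 2) :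
    ∃ D : ℝ≥0, ∀ s : Finset ι,
    (∀ g : M → ℂ, MemLp g 2 μ →
      ∑ ξ ∈ s, ‖LFourier v g ξ‖ₑ ^ 2 ≤ B * ∫⁻ x, ‖g x‖ₑ ^ 2 ∂μ) →
    ∀ W : ι → ℝ≥0∞, (∀ ξ ∈ s, W ξ ≠ 0) → (∀ ξ ∈ s, W ξ ≠ ⊤) →
    (∀ ξ ∈ s, supNorm (v ξ) ≤ K * W ξ) →
    ∀ φ : ι → ℝ, (∀ ξ ∈ s, 0 < φ ξ) → ∀ m : ℝ≥0, 0 < m →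
    (∀ t : ℝ, 0 < t → ENNReal.ofReal t * ∑ ξ ∈ s with t ≤ φ ξ, W ξ ^ 2 ≤ m) →
    ∀ f : M → ℂ, MemLp f (ENNReal.ofReal p) μ →
    ∑ ξ ∈ s, ‖LFourier v f ξ‖ₑ ^ p * (ENNReal.ofReal (φ ξ) * W ξ) ^ (2 - p) ≤
      D * (m : ℝ≥0∞) ^ (2 - p) * eLpNorm f (ENNReal.ofReal p) μ ^ p := by
  simp only [← lintegral_enorm_rpow_eq _ (by linarith : 0 < p)]
  rcases hp2.lt_or_eq with hp2 | rfl
  · exact exists_paley_bound_of_lt_two B K hp hp2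
  · refine ⟨B, fun s hB W _ _ _ φ _ m _ _ f hf => ?_⟩
    simpa using hB f (by simpa using hf)

/-! ### The Hausdorff–Young inequality -/

/-- The **Hausdorff–Young inequality** on finite sets of indices, deduced from Paley's inequality by
the choice `φ = (|F f| / ‖v‖_∞) ^ q`, for which the sum to be estimated is itself an admissible
constant `m`. -/
theorem exists_hausdorffYoung_bound (B : ℝ≥0) {p q : ℝ} (hpq : p.HolderConjugate q)
    (hp2 : p ≤ 2) :
    ∃ D : ℝ≥0, ∀ s : Finset ι,
    (∀ t ⊆ s, ∀ g : M → ℂ, MemLp g 2 μ →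
      ∑ ξ ∈ t, ‖LFourier v g ξ‖ₑ ^ 2 ≤ B * ∫⁻ x, ‖g x‖ₑ ^ 2 ∂μ) →
    (∀ ξ ∈ s, supNorm (v ξ) ≠ 0) → (∀ ξ ∈ s, supNorm (v ξ) ≠ ⊤) →
    ∀ f : M → ℂ, MemLp f (ENNReal.ofReal p) μ →
    ∑ ξ ∈ s, ‖LFourier v f ξ‖ₑ ^ q * supNorm (v ξ) ^ (2 - q) ≤
      D * eLpNorm f (ENNReal.ofReal p) μ ^ q := by
  classical
  have hp := hpq.lt
  have hq0 := hpq.symm.pos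
  have hp1 : 0 < p - 1 := by linarith
  have hmul : p * q = p + q := by rw [hpq.mul_eq_add]
  have hq : q = p * (p - 1)⁻¹ := by
    field_simp; linarith
  obtain ⟨D, hD⟩ := exists_paley_bound (v := v) B 1 hp hp2
  refine ⟨D ^ (p - 1)⁻¹, fun s hB hv0 hv f hf => ?_⟩
  -- Indices with a zero coefficient are dropped, since `φ` must be positive.
  set s' := s.filter fun ξ => ‖LFourier v f ξ‖ₑ ≠ 0 with hs'
  have hss : s' ⊆ s := Finset.filter_subset _ _
  have hsum : ∑ ξ ∈ s, ‖LFourier v f ξ‖ₑ ^ q * supNorm (v ξ) ^ (2 - q) =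
      ∑ ξ ∈ s', ‖LFourier v f ξ‖ₑ ^ q * supNorm (v ξ) ^ (2 - q) := by
    refine (Finset.sum_subset hss fun ξ hξ hξ' => ?_).symm
    have : ‖LFourier v f ξ‖ₑ = 0 := by
      by_contra h
      exact hξ' (Finset.mem_filter.2 ⟨hξ, h⟩)
    rw [this, ENNReal.zero_rpow_of_pos hq0, zero_mul]
  rw [hsum]
  set S := ∑ ξ ∈ s', ‖LFourier v f ξ‖ₑ ^ q * supNorm (v ξ) ^ (2 - q) with hS
  rcases eq_or_ne S 0 with h0 | h0
  · rw [h0]; exact zero_le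
  have hx0 : ∀ ξ ∈ s', ‖LFourier v f ξ‖ₑ ≠ 0 := fun ξ hξ => (Finset.mem_filter.1 hξ).2
  have hST : S ≠ ⊤ := by
    refine ENNReal.sum_ne_top.2 fun ξ hξ => ENNReal.mul_ne_top
      (ENNReal.rpow_ne_top_of_nonneg hq0.le enorm_ne_top) ?_
    exact ENNReal.rpow_ne_top_of_ne_zero (hv0 ξ (hss hξ)) (hv ξ (hss hξ))
  have hdiv0 : ∀ ξ ∈ s', ‖LFourier v f ξ‖ₑ / supNorm (v ξ) ≠ 0 := fun ξ hξ =>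
    ENNReal.div_ne_zero.2 ⟨hx0 ξ hξ, hv ξ (hss hξ)⟩
  have hdivT : ∀ ξ ∈ s', ‖LFourier v f ξ‖ₑ / supNorm (v ξ) ≠ ⊤ := fun ξ hξ =>
    ENNReal.div_ne_top enorm_ne_top (hv0 ξ (hss hξ))
  set φ : ι → ℝ := fun ξ => ((‖LFourier v f ξ‖ₑ / supNorm (v ξ)) ^ q).toReal with hφ
  have hφe : ∀ ξ ∈ s', ENNReal.ofReal (φ ξ) = (‖LFourier v f ξ‖ₑ / supNorm (v ξ)) ^ q :=
    fun ξ hξ => ENNReal.ofReal_toReal (ENNReal.rpow_ne_top_of_nonneg hq0.le (hdivT ξ hξ))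
  have hφ0 : ∀ ξ ∈ s', 0 < φ ξ := by
    intro ξ hξ
    rw [← ENNReal.ofReal_pos, hφe ξ hξ]
    exact ENNReal.rpow_pos (pos_iff_ne_zero.2 (hdiv0 ξ hξ)) (hdivT ξ hξ)
  have hterm1 : ∀ ξ ∈ s', ENNReal.ofReal (φ ξ) * supNorm (v ξ) ^ 2 =
      ‖LFourier v f ξ‖ₑ ^ q * supNorm (v ξ) ^ (2 - q) := by
    intro ξ hξ
    rw [hφe ξ hξ, ENNReal.div_rpow_of_nonneg _ _ hq0.le, ENNReal.rpow_sub _ _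
      (hv0 ξ (hss hξ)) (hv ξ (hss hξ)), ENNReal.rpow_two, div_eq_mul_inv, div_eq_mul_inv]
    ring
  have hterm2 : ∀ ξ ∈ s', ‖LFourier v f ξ‖ₑ ^ p *
      (ENNReal.ofReal (φ ξ) * supNorm (v ξ)) ^ (2 - p) =
      ‖LFourier v f ξ‖ₑ ^ q * supNorm (v ξ) ^ (2 - q) := by
    intro ξ hξ
    rw [hφe ξ hξ, div_eq_mul_inv, ENNReal.mul_rpow_of_nonneg _ _ hq0.le,
      ENNReal.mul_rpow_of_nonneg _ _ (by linarith : 0 ≤ 2 - p),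
      ENNReal.mul_rpow_of_nonneg _ _ (by linarith : 0 ≤ 2 - p),
      ← ENNReal.rpow_neg_one, ← ENNReal.rpow_mul, ← ENNReal.rpow_mul, ← ENNReal.rpow_mul,
      mul_assoc, ← ENNReal.rpow_add _ _ (hv0 ξ (hss hξ)) (hv ξ (hss hξ)), ← mul_assoc,
      ← ENNReal.rpow_add _ _ (hx0 ξ hξ) enorm_ne_top]
    congr 2
    · linarith
    · linarith
  have hS' : ((S.toNNReal : ℝ≥0) : ℝ≥0∞) = S := ENNReal.coe_toNNReal hST
  have main := hD s' (hB s' hss) (fun ξ => supNorm (v ξ)) (fun ξ hξ => hv0 ξ (hss hξ))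
    (fun ξ hξ => hv ξ (hss hξ)) (fun ξ _ => by simp) φ hφ0 S.toNNReal
    (ENNReal.toNNReal_pos h0 hST) (fun t ht => by
      rw [hS', hS, Finset.mul_sum]
      refine (Finset.sum_le_sum fun ξ hξ => ?_).trans
        (Finset.sum_le_sum_of_subset (Finset.filter_subset _ _))
      rw [← hterm1 ξ (Finset.mem_filter.1 hξ).1]
      gcongr
      exact (Finset.mem_filter.1 hξ).2) f hf
  rw [Finset.sum_congr rfl hterm2, ← hS, hS'] at main
  -- `S ≤ D * S ^ (2 - p) * ‖f‖_p ^ p` with `S` finite and nonzero, so `S ^ (2 - p)` cancels.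
  have hpow : S ^ (p - 1) ≤ D * eLpNorm f (ENNReal.ofReal p) μ ^ p := by
    have e : S ^ (p - 1) = S ^ (-(2 - p)) * S := by
      nth_rw 3 [← ENNReal.rpow_one S]
      rw [← ENNReal.rpow_add _ _ h0 hST]; ring_nf
    rw [e]
    calc _ ≤ S ^ (-(2 - p)) * (D * S ^ (2 - p) * eLpNorm f (ENNReal.ofReal p) μ ^ p) := by
          gcongr
      _ = (S ^ (-(2 - p)) * S ^ (2 - p)) * (D * eLpNorm f (ENNReal.ofReal p) μ ^ p) := by ring
      _ = _ := by rw [← ENNReal.rpow_add _ _ h0 hST]; simp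
  calc S = (S ^ (p - 1)) ^ (p - 1)⁻¹ := (ENNReal.rpow_rpow_inv hp1.ne' _).symm
    _ ≤ (D * eLpNorm f (ENNReal.ofReal p) μ ^ p) ^ (p - 1)⁻¹ := by gcongr
    _ = _ := by
      rw [ENNReal.mul_rpow_of_nonneg _ _ (by positivity), ← ENNReal.rpow_mul, ← hq,
        ENNReal.coe_rpow_of_nonneg _ (by positivity)]

/-! ### Interpolation between the two endpoints -/

/-- Hölder's inequality for sums, in the form of log-convexity. -/
theorem tsum_rpow_mul_rpow_le (f g : ι → ℝ≥0∞) {a b : ℝ} (ha : 0 ≤ a) (hb : 0 ≤ b)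
    (hab : a + b = 1) :
    ∑' i, f i ^ a * g i ^ b ≤ (∑' i, f i) ^ a * (∑' i, g i) ^ b := by
  let _ : MeasurableSpace ι := ⊤
  simp only [← lintegral_count]
  exact ENNReal.lintegral_mul_norm_pow_le measurable_from_top.aemeasurable
    measurable_from_top.aemeasurable ha hb hab

theorem ofReal_mul_sum_filter_le_paleyConst (u : ι → Lp ℂ 2 μ) (φ : ι → ℝ) (s : Finset ι) {t : ℝ}
    (ht : 0 < t) :
    ENNReal.ofReal t * ∑ ξ ∈ s with t ≤ φ ξ, supNorm (u ξ) ^ 2 ≤ paleyConst u φ := by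
  refine le_trans ?_ (le_iSup (fun t : {t : ℝ // 0 < t} => ENNReal.ofReal t *
    ∑' ξ : {ξ : ι // (t : ℝ) ≤ φ ξ}, supNorm (u ξ) ^ 2) ⟨t, ht⟩)
  gcongr
  rw [← Finset.sum_subtype_eq_sum_filter]
  exact ENNReal.sum_le_tsum (f := fun ξ : {ξ : ι // t ≤ φ ξ} => supNorm (u ξ) ^ 2) _

/-- The level `t = φ ξ` shows that finiteness of `M_φ` makes `u ξ` essentially bounded. -/
theorem supNorm_ne_top_of_paleyConst {u : ι → Lp ℂ 2 μ} {φ : ι → ℝ} {ξ : ι} (hφ : 0 < φ ξ)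
    (h : paleyConst u φ < ⊤) : supNorm (u ξ) ≠ ⊤ := by
  intro hu
  have := ofReal_mul_sum_filter_le_paleyConst u φ {ξ} hφ
  rw [Finset.filter_true_of_mem (by simp), Finset.sum_singleton, hu] at this
  simp [ENNReal.mul_top, hφ] at this
  exact h.ne this

theorem supNorm_ne_zero {w : Lp ℂ 2 μ} (hw : w ≠ 0) : supNorm w ≠ 0 := by
  intro h
  rw [supNorm, eLpNorm_eq_zero_iff (Lp.aestronglyMeasurable w) (by simp)] at h
  exact hw ((Lp.eq_zero_iff_ae_eq_zero).2 h)

theorem paleyConst_pos {u : ι → Lp ℂ 2 μ} {φ : ι → ℝ} {ξ : ι} (hφ : 0 < φ ξ) (hu : u ξ ≠ 0) :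
    0 < paleyConst u φ := by
  refine lt_of_lt_of_le ?_ (ofReal_mul_sum_filter_le_paleyConst u φ {ξ} hφ)
  rw [Finset.filter_true_of_mem (by simp), Finset.sum_singleton]
  exact ENNReal.mul_pos (by simpa using hφ) (pow_ne_zero _ (supNorm_ne_zero hu))

/-- For `b = a p + c q`, the summand of the Hausdorff–Young–Paley inequality is a geometric mean of
the Paley summand and the Hausdorff–Young summand. -/
theorem hausdorffYoungPaley_term_eq {p q a c b : ℝ} (hpq : p.HolderConjugate q) (hp2 : p ≤ 2)
    (ha : 0 ≤ a) (hc : 0 ≤ c) (hac : a + c = 1) (hb : a * p + c * q = b)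
    (x y U V : ℝ≥0∞) :
    (x * y ^ (1 / b - 1 / q)) ^ b * U ^ (1 - b / q) * V ^ (1 - b / p) =
      (x ^ p * (y * U) ^ (2 - p)) ^ a * (x ^ q * V ^ (2 - q)) ^ c := by
  have hp := hpq.pos
  have hq := hpq.symm.pos
  have hmul : p * q = p + q := by rw [hpq.mul_eq_add]
  have hb0 : 0 < b := by
    rw [← hb]
    rcases ha.eq_or_lt with rfl | ha
    · have : c = 1 := by linarith
      subst this; linarith
    · have := mul_pos ha hp
      have := mul_nonneg hc hq.le
      linarith
  have e1 : (1 / b - 1 / q) * b = (2 - p) * a := by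
    field_simp; subst hb
    have : c = 1 - a := by linarith
    subst this; linear_combination a * hmul
  have e2 : 1 - b / q = (2 - p) * a := by
    rw [← e1]; field_simp
  have e3 : 1 - b / p = (2 - q) * c := by
    field_simp; subst hb
    have : a = 1 - c := by linarith
    subst this; linear_combination c * hmul
  rw [ENNReal.mul_rpow_of_nonneg _ _ hb0.le, ← ENNReal.rpow_mul, e1, e2, e3,
    ENNReal.mul_rpow_of_nonneg _ _ ha, ENNReal.mul_rpow_of_nonneg _ _ hc,
    ENNReal.mul_rpow_of_nonneg _ _ (by linarith : 0 ≤ 2 - p), ENNReal.mul_rpow_of_nonneg _ _ ha,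
    ← ENNReal.rpow_mul, ← ENNReal.rpow_mul, ← ENNReal.rpow_mul, ← ENNReal.rpow_mul,
    ← ENNReal.rpow_mul, ← hb, mul_comm a, mul_comm c,
    ENNReal.rpow_add_of_nonneg _ _ (by positivity) (by positivity)]
  ring
end

theorem mainTheorem6
    {n : ℕ} {H : Type*} [TopologicalSpace H]
    (I : ModelWithCorners ℝ (EuclideanSpace ℝ (Fin n)) H)
    {M : Type*} [TopologicalSpace M] [T2Space M] [SecondCountableTopology M]
    [ChartedSpace H M] [IsManifold I ∞ M] [MeasurableSpace M] [BorelSpace M]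
    (μ : Measure M) (hμ : IsSmoothDensity I μ)
    {ι : Type*} [Countable ι]
    (L : Lp ℂ 2 μ →ₗ.[ℂ] Lp ℂ 2 μ) (lam : ι → ℂ) (u v : ι → Lp ℂ 2 μ)
    (hsys : IsBiorthogonalEigensystem L lam u v)
    (hratio : (⨆ ξ, supNorm (v ξ) / supNorm (u ξ)) < ⊤)
    (p : ℝ) (hp : 1 < p) (hp2 : p ≤ 2) :
    ∃ C : ℝ≥0, ∀ b : ℝ, p ≤ b → b ≤ p.conjExponent →
      ∀ φ : ι → ℝ, (∀ ξ, 0 < φ ξ) → paleyConst u φ < ⊤ →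
        ∀ f : M → ℂ, MemLp f (ENNReal.ofReal p) μ →
          (∀ ξ, Integrable (fun x => f x * conj (v ξ x)) μ) ∧
          (∑' ξ, (‖LFourier v f ξ‖ₑ *
                ENNReal.ofReal (φ ξ) ^ (1 / b - 1 / p.conjExponent)) ^ b *
              supNorm (u ξ) ^ (1 - b / p.conjExponent) *
              supNorm (v ξ) ^ (1 - b / p)) ^ (1 / b) ≤
            C * paleyConst u φ ^ (1 / b - 1 / p.conjExponent) *
              eLpNorm f (ENNReal.ofReal p) μ := by
  obtain ⟨B, hB⟩ := hsys.exists_bessel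
  set K := (⨆ ξ, supNorm (v ξ) / supNorm (u ξ)).toNNReal with hK
  have hpq : p.HolderConjugate p.conjExponent := Real.HolderConjugate.conjExponent hp
  set q := p.conjExponent
  obtain ⟨D₁, hD₁⟩ := exists_paley_bound (v := v) B K hp hp2
  obtain ⟨D₂, hD₂⟩ := exists_hausdorffYoung_bound (v := v) B hpq hp2
  -- `1 ≤ C`, so that `C ^ (1 / b) ≤ C` and the constant does not depend on `b`.
  set C := max 1 (max D₁ D₂) with hC
  refine ⟨C, fun b hpb hbq φ hφ hM f hf => ?_⟩
  have hu0 : ∀ ξ, u ξ ≠ 0 := fun ξ h => by simpa [h] using hsys.norm_eq_one ξ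
  have hv0 : ∀ ξ, v ξ ≠ 0 := by
    intro ξ h
    have h1 := hsys.biorthogonal_self ξ
    rw [← L2_inner_eq_integral, h, inner_zero_left] at h1
    exact zero_ne_one h1
  have hu : ∀ ξ, supNorm (u ξ) ≠ ⊤ := fun ξ => supNorm_ne_top_of_paleyConst (hφ ξ) hM
  -- As `supNorm (u ξ)` is neither `0` nor `∞`, the quotient in `hratio` is a genuine one.
  have hvu : ∀ ξ, supNorm (v ξ) ≤ K * supNorm (u ξ) := by
    intro ξ
    rw [hK, ENNReal.coe_toNNReal hratio.ne,
      ← ENNReal.div_le_iff (supNorm_ne_zero (hu0 ξ)) (hu ξ)]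
    exact le_iSup (fun ξ => supNorm (v ξ) / supNorm (u ξ)) ξ
  have hv : ∀ ξ, supNorm (v ξ) ≠ ⊤ := fun ξ =>
    ne_top_of_le_ne_top (ENNReal.mul_ne_top ENNReal.coe_ne_top (hu ξ)) (hvu ξ)
  refine ⟨fun ξ => integrable_mul_conj hp hp2 hf (hv ξ), ?_⟩
  set Mφ := paleyConst u φ with hMφ
  set N := eLpNorm f (ENNReal.ofReal p) μ with hN
  have hpaley : ∑' ξ, ‖LFourier v f ξ‖ₑ ^ p * (ENNReal.ofReal (φ ξ) * supNorm (u ξ)) ^ (2 - p) ≤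
      C * Mφ ^ (2 - p) * N ^ p := by
    rw [ENNReal.tsum_eq_iSup_sum]
    refine iSup_le fun s => ?_
    -- A nonempty index set is what makes `Mφ` positive.
    rcases s.eq_empty_or_nonempty with rfl | ⟨ξ, -⟩
    · simp
    have hm : ((Mφ.toNNReal : ℝ≥0) : ℝ≥0∞) = Mφ := ENNReal.coe_toNNReal hM.ne
    have := hD₁ s (hB s) (fun ξ => supNorm (u ξ)) (fun ξ _ => supNorm_ne_zero (hu0 ξ))
      (fun ξ _ => hu ξ) (fun ξ _ => hvu ξ) φ (fun ξ _ => hφ ξ) Mφ.toNNReal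
      (ENNReal.toNNReal_pos (paleyConst_pos (hφ ξ) (hu0 ξ)).ne' hM.ne)
      (fun t ht => by rw [hm]; exact ofReal_mul_sum_filter_le_paleyConst u φ s ht) f hf
    rw [hm] at this
    refine this.trans ?_
    gcongr
    exact (le_max_left _ _).trans (le_max_right _ _)
  have hHY : ∑' ξ, ‖LFourier v f ξ‖ₑ ^ q * supNorm (v ξ) ^ (2 - q) ≤ C * N ^ q := by
    rw [ENNReal.tsum_eq_iSup_sum]
    refine iSup_le fun s => (hD₂ s (fun t _ => hB t) (fun ξ _ => supNorm_ne_zero (hv0 ξ))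
      (fun ξ _ => hv ξ) f hf).trans ?_
    gcongr
    exact (le_max_right _ _).trans (le_max_right _ _)
  have hb : b ∈ segment ℝ p q := by
    rw [segment_eq_Icc (hpb.trans hbq)]; exact ⟨hpb, hbq⟩
  obtain ⟨a, c, ha, hc, hac, hb⟩ := hb
  simp only [smul_eq_mul] at hb
  have hb0 : 0 < b := by linarith
  have hexp : (2 - p) * a * (1 / b) = 1 / b - 1 / q := by
    have hq := hpq.symm.pos
    have hmul : p * q = p + q := by rw [hpq.mul_eq_add]
    have : c = 1 - a := by linarith
    field_simp; subst this; rw [← hb]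
    linear_combination (-a) * hmul
  calc _ = (∑' ξ, (‖LFourier v f ξ‖ₑ ^ p *
          (ENNReal.ofReal (φ ξ) * supNorm (u ξ)) ^ (2 - p)) ^ a *
          (‖LFourier v f ξ‖ₑ ^ q * supNorm (v ξ) ^ (2 - q)) ^ c) ^ (1 / b) := by
        congr 2
        funext ξ
        exact hausdorffYoungPaley_term_eq hpq hp2 ha hc hac hb _ _ _ _
    _ ≤ ((C * Mφ ^ (2 - p) * N ^ p) ^ a * (C * N ^ q) ^ c) ^ (1 / b) := by
        gcongr
        refine (tsum_rpow_mul_rpow_le _ _ ha hc hac).trans ?_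
        gcongr
    _ = (C : ℝ≥0∞) ^ (1 / b) * Mφ ^ (1 / b - 1 / q) * N := by
        have hp0 : 0 ≤ a * p := by positivity
        have hq0 : 0 ≤ c * q := mul_nonneg hc hpq.symm.nonneg
        have e : ((C : ℝ≥0∞) * Mφ ^ (2 - p) * N ^ p) ^ a * (C * N ^ q) ^ c =
            C * Mφ ^ ((2 - p) * a) * N ^ b := by
          rw [ENNReal.mul_rpow_of_nonneg _ _ ha, ENNReal.mul_rpow_of_nonneg _ _ ha,
            ENNReal.mul_rpow_of_nonneg _ _ hc, ← ENNReal.rpow_mul, ← ENNReal.rpow_mul,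
            ← ENNReal.rpow_mul, ← hb, ENNReal.rpow_add_of_nonneg _ _ hp0 hq0, mul_comm p,
            mul_comm q]
          nth_rw 3 [← ENNReal.rpow_one (C : ℝ≥0∞)]
          rw [← hac, ENNReal.rpow_add_of_nonneg _ _ ha hc]
          ring
        have hb1 : 0 ≤ 1 / b := by positivity
        rw [e, ENNReal.mul_rpow_of_nonneg _ _ hb1, ENNReal.mul_rpow_of_nonneg _ _ hb1,
          ← ENNReal.rpow_mul, ← ENNReal.rpow_mul, hexp, mul_one_div_cancel hb0.ne',
          ENNReal.rpow_one]
    _ ≤ C * Mφ ^ (1 / b - 1 / q) * N := by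
        gcongr
        refine (ENNReal.rpow_le_rpow_of_exponent_le (y := 1 / b) (z := 1) ?_ ?_).trans_eq
          (ENNReal.rpow_one _)
        · exact_mod_cast le_max_left 1 _
        · rw [div_le_one hb0]; linarith
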